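/- Let $p$ be an odd prime and $S$ a finite $p$-group. For a subgroup $H \le S$ let $\Omega_1(H)$ be the subgroup generated by the elements $x \in H$ with $x^p = 1$, and for subgroups $A, B \le S$ let $[A,B;0]=A$ and $[A,B;m+1]=[[A,B;m],B]$. Let $\mathfrak{X}(S)$, the Oliver subgroup of $S$, be the largest subgroup of $S$ for which there is a series $1 = Q_0 < Q_1 < \cdots < Q_n = \mathfrak{X}(S)$ (with $n \ge 0$) such that each $Q_i$ is normal in $S$ and $[\Omega_1(C_S(Q_{i-1})), Q_i;\, p-1] = 1$ for all $1 \le i \le n$. Let $J_e(S)$, the Thompson subgroup of $S$, be the subgroup generated by the elementary abelian subgroups of $S$ of maximum order. If the quotient $G = S/\mathfrak{X}(S)$ has nilpotence class at most $\log_2(p-2)+1$, then $J_e(S) \le \mathfrak{X}(S)$; that is, Oliver's conjecture (the assertion that $J_e(S) \le \mathfrak{X}(S)$) holds for $S$. -/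

import Mathlib

/-- `Ω₁(H)`: the subgroup generated by the elements `x` of `H` with `x ^ p = 1`. -/
def omegaOne {S : Type*} [Group S] (p : ℕ) (H : Subgroup S) : Subgroup S :=
  Subgroup.closure {x | x ∈ H ∧ x ^ p = 1}

/-- The left-normed iterated commutator `[A, B; n] = [A, B, …, B]` with `n` copies of `B`. -/
def iterCommutator {S : Type*} [Group S] (A B : Subgroup S) : ℕ → Subgroup S
  | 0 => A
  | n + 1 => ⁅iterCommutator A B n, B⁆

/-- `Q 0 < Q 1 < ⋯ < Q n` is a series from `1` to `K` of normal subgroups of `S` such that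
`[Ω₁(C_S(Q (i - 1))), Q i; p - 1] = 1` for `1 ≤ i ≤ n`. -/
structure IsOliverSeries {S : Type*} [Group S] (p n : ℕ) (Q : ℕ → Subgroup S)
    (K : Subgroup S) : Prop where
  start : Q 0 = ⊥
  finish : Q n = K
  normal : ∀ i ≤ n, (Q i).Normal
  lt : ∀ i < n, Q i < Q (i + 1)
  commutator_eq : ∀ i < n,
    iterCommutator (omegaOne p (Subgroup.centralizer (Q i : Set S))) (Q (i + 1)) (p - 1) = ⊥

/-- `K` is the last term of some series as in `IsOliverSeries`. -/
def HasOliverSeries {S : Type*} [Group S] (p : ℕ) (K : Subgroup S) : Prop :=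
  ∃ (n : ℕ) (Q : ℕ → Subgroup S), IsOliverSeries p n Q K

/-- The Oliver subgroup `𝔛(S)`: the largest subgroup of `S` that is the last term of a series as
in `IsOliverSeries`. It is written as a supremum; `isGreatest_oliverSubgroup` below shows that
the supremum is attained when `S` is finite. -/
def oliverSubgroup (p : ℕ) (S : Type*) [Group S] : Subgroup S :=
  sSup {K : Subgroup S | HasOliverSeries p K}

/-- `A` is an elementary abelian `p`-subgroup (possibly trivial). -/
def IsElementaryAbelian {S : Type*} [Group S] (p : ℕ) (A : Subgroup S) : Prop :=
  (∀ a ∈ A, ∀ b ∈ A, a * b = b * a) ∧ ∀ a ∈ A, a ^ p = 1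

/-- The Thompson subgroup `J_e(S)`, generated by the elementary abelian `p`-subgroups of `S` of
maximum order. -/
def thompsonSubgroup (p : ℕ) (S : Type*) [Group S] : Subgroup S :=
  sSup {A : Subgroup S | IsElementaryAbelian p A ∧
    ∀ B : Subgroup S, IsElementaryAbelian p B → Nat.card B ≤ Nat.card A}

theorem HasOliverSeries.normal {S : Type*} [Group S] {p : ℕ} {K : Subgroup S}
    (h : HasOliverSeries p K) : K.Normal := by
  obtain ⟨n, Q, hQ⟩ := h
  exact hQ.finish ▸ hQ.normal n le_rfl

instance oliverSubgroup_normal (p : ℕ) (S : Type*) [Group S] : (oliverSubgroup p S).Normal :=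
  Subgroup.sSup_normal _ fun _ h => h.normal

theorem HasOliverSeries.bot {S : Type*} [Group S] (p : ℕ) :
    HasOliverSeries p (⊥ : Subgroup S) :=
  ⟨0, fun _ => ⊥, rfl, rfl, fun _ _ => inferInstance, by simp, by simp⟩

theorem HasOliverSeries.step {S : Type*} [Group S] {p : ℕ} {K L : Subgroup S}
    (h : HasOliverSeries p K) (hL : L.Normal) (hKL : K ≤ L)
    (hc : iterCommutator (omegaOne p (Subgroup.centralizer (K : Set S))) L (p - 1) = ⊥) :
    HasOliverSeries p L := by
  rcases hKL.eq_or_lt with rfl | hlt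
  · exact h
  obtain ⟨n, Q, hQ⟩ := h
  refine ⟨n + 1, fun i => if i ≤ n then Q i else L, by simp [hQ.start], by simp, ?_, ?_, ?_⟩
  · intro i _
    by_cases hi : i ≤ n
    · simpa [hi] using hQ.normal i hi
    · simpa [hi] using hL
  · intro i hi
    rcases (Nat.lt_succ_iff.mp hi).eq_or_lt with rfl | h'
    · simpa [hQ.finish] using hlt
    · simpa [h'.le, Nat.succ_le_of_lt h'] using hQ.lt i h'
  · intro i hi
    rcases (Nat.lt_succ_iff.mp hi).eq_or_lt with rfl | h'
    · simpa [hQ.finish] using hc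
    · simpa [h'.le, Nat.succ_le_of_lt h'] using hQ.commutator_eq i h'

theorem omegaOne_le {S : Type*} [Group S] (p : ℕ) (H : Subgroup S) : omegaOne p H ≤ H :=
  (Subgroup.closure_le _).2 fun _ h => h.1

theorem omegaOne_mono {S : Type*} [Group S] (p : ℕ) {H K : Subgroup S} (h : H ≤ K) :
    omegaOne p H ≤ omegaOne p K :=
  Subgroup.closure_mono fun _ hx => ⟨h hx.1, hx.2⟩

instance omegaOne_normal {S : Type*} [Group S] (p : ℕ) (H : Subgroup S) [hH : H.Normal] :
    (omegaOne p H).Normal := by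
  constructor
  intro x hx g
  have : (omegaOne p H) ≤ (omegaOne p H).comap (MulAut.conj g).toMonoidHom := by
    refine (Subgroup.closure_le _).2 fun y hy => ?_
    refine Subgroup.subset_closure ⟨hH.conj_mem y hy.1 g, ?_⟩
    change (g * y * g⁻¹) ^ p = 1
    rw [conj_pow, hy.2]; simp
  exact this hx

open scoped commutatorElement in
theorem iterCommutator_sup_le {S : Type*} [Group S] {U U' Q R : Subgroup S}
    (hU : U.Normal) (hU' : U'.Normal) (hQ : Q.Normal) (hR : R.Normal) (hUU' : U ≤ U')
    (hUQ : U ≤ Subgroup.centralizer (Q : Set S)) (n : ℕ) :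
    iterCommutator U (Q ⊔ R) n ≤ U ∧ (iterCommutator U' R n).Normal ∧
      iterCommutator U (Q ⊔ R) n ≤ iterCommutator U' R n := by
  induction n with
  | zero => exact ⟨le_rfl, hU', hUU'⟩
  | succ n ih =>
    obtain ⟨h1, h2, h3⟩ := ih
    have h4 : (iterCommutator U' R (n + 1)).Normal := Subgroup.commutator_normal _ _
    refine ⟨?_, h4, ?_⟩
    · exact (Subgroup.commutator_mono h1 le_rfl).trans (Subgroup.commutator_le_left _ _)
    · refine Subgroup.commutator_le.2 fun u hu x hx => ?_
      obtain ⟨q, hq, r, hr, rfl⟩ := Subgroup.mem_sup_of_normal_left.1 hx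
      have hc : q * u = u * q := Subgroup.mem_centralizer_iff.1 (hUQ (h1 hu)) q hq
      have : ⁅u, q * r⁆ = q * ⁅u, r⁆ * q⁻¹ := by
        rw [commutatorElement_def, commutatorElement_def]
        simp only [← mul_assoc, hc, mul_inv_rev]
      rw [this]
      exact h4.conj_mem _ (Subgroup.commutator_mem_commutator (h3 hu) hr) q

theorem HasOliverSeries.sup {S : Type*} [Group S] {p : ℕ} {K L : Subgroup S}
    (hK : HasOliverSeries p K) (hL : HasOliverSeries p L) : HasOliverSeries p (K ⊔ L) := by
  obtain ⟨n, R, hR⟩ := hL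
  have key : ∀ i ≤ n, HasOliverSeries p (K ⊔ R i) := by
    intro i
    induction i with
    | zero => intro _; simpa [hR.start] using hK
    | succ i ih =>
      intro hi
      have hKn := hK.normal
      have hRi := hR.normal i (by omega)
      have hRi' := hR.normal (i + 1) hi
      refine (ih (by omega)).step inferInstance (sup_le_sup_left (hR.lt i hi).le K) ?_
      rw [eq_bot_iff, ← hR.commutator_eq i hi]
      refine (iterCommutator_sup_le inferInstance inferInstance hKn hRi'
        (omegaOne_mono p ?_) ((omegaOne_le p _).trans ?_) _).2.2
      · exact Subgroup.centralizer_le (SetLike.coe_subset_coe.2 le_sup_right)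
      · exact Subgroup.centralizer_le (SetLike.coe_subset_coe.2 le_sup_left)
  simpa [hR.finish] using key n le_rfl

/-- In a finite group the Oliver subgroup is the largest subgroup with an Oliver series. -/
theorem isGreatest_oliverSubgroup (p : ℕ) (S : Type*) [Group S] [Finite S] :
    IsGreatest {K : Subgroup S | HasOliverSeries p K} (oliverSubgroup p S) := by
  refine ⟨?_, fun K hK => le_sSup hK⟩
  obtain ⟨M, hM⟩ := (Set.toFinite {K : Subgroup S | HasOliverSeries p K}).exists_maximal
    ⟨⊥, HasOliverSeries.bot p⟩
  have : oliverSubgroup p S = M := by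
    refine le_antisymm (sSup_le fun K hK => ?_) (le_sSup hM.1)
    exact le_sup_right.trans (hM.2 (HasOliverSeries.sup hM.1 hK) le_sup_left)
  rw [this]
  exact hM.1

/-! Let X be the Oliver subgroup, V = Ω₁(C_S(X)) and G = S/X. Since C_S(X) ≤ X
(`centralizer_oliverSubgroup_le`), V is elementary abelian and G acts on it. By maximality of X, no
central z ≠ 1 of G satisfies (z - 1)^(p - 1) = 0 on V; the proof contradicts this.

Suppose A is elementary abelian of maximum order and A ≰ X. As (A ∩ X)V is elementary abelian, its
order is at most |A|, so E = AX/X satisfies |V| ≤ |E| |C_V(E)|. A replacement argument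
(`exists_quadratic_of_card_le`) then yields x ≠ 1 in G with (x - 1)² = 0.

Such a quadratic element is pushed into the centre (`exists_mem_center_of_quadratic`). Take x as low
as possible in the upper central series. If two conjugates of x failed to commute, they would
produce a lower quadratic commutator, because p is odd. So the normal closure of x is abelian, and
each commutator with x descends one central step while at most doubling d in (x - 1)^(d + 1) = 0. In
class c this ends at a central z ≠ 1 with (z - 1)^(2^(c - 1) + 1) = 0, and the class bound says
exactly that 2^(c - 1) + 1 ≤ p - 1. -/

/-- If `x` and `z` are commuting units of a ring without `2`-torsion and `x - 1`, `x * z - 1` and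
`x * z⁻¹ - 1` square to zero, then so does `z - 1`. -/
theorem sub_one_sq_eq_zero_of_mul {R : Type*} [Ring R] (h2 : ∀ r : R, 2 * r = 0 → r = 0)
    {x y z w : R} (hxy : x * y = 1) (hzw : z * w = 1) (hwz : w * z = 1) (hxz : Commute x z)
    (hx : (x - 1) ^ 2 = 0) (h₁ : (x * z - 1) ^ 2 = 0) (h₃ : (x * w - 1) ^ 2 = 0) :
    (z - 1) ^ 2 = 0 := by
  have hw : Commute z w := hzw.trans hwz.symm
  have e₀ : x * x - 2 * x + 1 = 0 := by rw [← hx]; noncomm_ring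
  have e₁ : x * x * (z * z) - 2 * (x * z) + 1 = 0 := by
    have : x * z * (x * z) = x * x * (z * z) := by
      rw [mul_assoc, ← mul_assoc z, ← hxz.eq]; simp only [mul_assoc]
    rw [← this, ← h₁]; noncomm_ring
  have e₂ : x * x - 2 * (x * z) + z * z = 0 := by
    have hc : Commute (x * w - 1) z :=
      ((hxz.mul_left hw.symm).sub_left (Commute.one_left z))
    have hz : (x * w - 1) * z = x - z := by rw [sub_mul, mul_assoc, hwz]; simp
    have : (x - z) ^ 2 = 0 := by rw [← hz, hc.mul_pow, h₃, zero_mul]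
    have hzx : z * x = x * z := hxz.eq.symm
    calc x * x - 2 * (x * z) + z * z = x * x - x * z - x * z + z * z := by noncomm_ring
      _ = x * x - x * z - z * x + z * z := by rw [hzx]
      _ = (x - z) ^ 2 := by noncomm_ring
      _ = 0 := this
  -- The combination `e₁ + e₂ - e₀ - e₀ * z²` of the three quadratic relations isolates (z - 1)².
  have e₃ : 2 * (x * (z - 1) ^ 2) = 0 := by
    have : 2 * (x * (z - 1) ^ 2) = (x * x * (z * z) - 2 * (x * z) + 1)
        + (x * x - 2 * (x * z) + z * z) - (x * x - 2 * x + 1) - (x * x - 2 * x + 1) * (z * z) := by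
      noncomm_ring
    rw [this, e₀, e₁, e₂]; simp
  have e₄ := h2 _ e₃
  have hu : IsUnit x := by
    refine ⟨⟨x, y, hxy, ?_⟩, rfl⟩
    have : x * (2 - x) = 1 := by
      rw [← sub_eq_zero, ← neg_eq_zero, ← e₀]; noncomm_ring
    have h' : (2 - x) * x = 1 := by
      rw [← this]; noncomm_ring
    rw [← left_inv_eq_right_inv h' hxy]; exact h'
  exact hu.mul_right_eq_zero.1 e₄

/-! ### Quadratic elements of nilpotent linear groups -/

section Representation

variable {G R : Type*} [Group G] [Ring R] (ψ : G →* R)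

theorem map_conj_sub_one_pow (x g : G) (n : ℕ) (h : (ψ x - 1) ^ n = 0) :
    (ψ (g * x * g⁻¹) - 1) ^ n = 0 := by
  have hg : ψ g⁻¹ * ψ g = 1 := by rw [← map_mul]; simp
  have hg' : ψ g * ψ g⁻¹ = 1 := by rw [← map_mul]; simp
  let u : Rˣ := ⟨ψ g, ψ g⁻¹, hg', hg⟩
  have : ψ (g * x * g⁻¹) - 1 = (u : R) * (ψ x - 1) * ((u⁻¹ : Rˣ) : R) := by
    change _ = ψ g * (ψ x - 1) * ψ g⁻¹
    rw [mul_sub, sub_mul, mul_one, hg', map_mul, map_mul]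
  rw [this, Units.conj_pow, h]
  simp

theorem map_inv_sub_one_pow (x : G) (n : ℕ) (h : (ψ x - 1) ^ n = 0) :
    (ψ x⁻¹ - 1) ^ n = 0 := by
  have hx : ψ x⁻¹ * ψ x = 1 := by rw [← map_mul]; simp
  have hx' : ψ x * ψ x⁻¹ = 1 := by rw [← map_mul]; simp
  have h₁ : ψ x⁻¹ - 1 = -(ψ x⁻¹ * (ψ x - 1)) := by rw [mul_sub, hx]; simp
  have hc : Commute (ψ x⁻¹) (ψ x - 1) := Commute.sub_right (hx.trans hx'.symm) (Commute.one_right _)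
  rw [h₁, neg_pow, hc.mul_pow, h]; simp

/-- Since xy - 1 = (x - 1)y + (y - 1) is a sum of commuting nilpotents, the binomial expansion
applies. -/
theorem map_mul_sub_one_pow {x y : G} (hxy : Commute x y) {m n k : ℕ}
    (hx : (ψ x - 1) ^ m = 0) (hy : (ψ y - 1) ^ n = 0) (hk : m + n ≤ k + 1) :
    (ψ (x * y) - 1) ^ k = 0 := by
  have hc : Commute (ψ x) (ψ y) := hxy.map ψ
  have hc₁ : Commute (ψ x - 1) (ψ y) := hc.sub_left (Commute.one_left _)
  have hc₂ : Commute (ψ x - 1) (ψ y - 1) := hc₁.sub_right (Commute.one_right _)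
  have h : ψ (x * y) - 1 = (ψ x - 1) * ψ y + (ψ y - 1) := by rw [map_mul]; noncomm_ring
  rw [h]
  refine Commute.add_pow_eq_zero_of_add_le_succ_of_pow_eq_zero (m := m) (n := n) ?_ ?_ hy hk
  · exact hc₂.mul_left (Commute.sub_right (Commute.refl _) (Commute.one_right _))
  · rw [hc₁.mul_pow, hx, zero_mul]

open scoped commutatorElement

/-- A commutator with a quadratic element that commutes with both entries is quadratic. -/
theorem commutator_sub_one_sq (h2 : ∀ r : R, 2 * r = 0 → r = 0) {u x : G}
    (hx : (ψ x - 1) ^ 2 = 0) (hcu : Commute ⁅u, x⁆ u) (hcx : Commute ⁅u, x⁆ x) :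
    (ψ ⁅u, x⁆ - 1) ^ 2 = 0 := by
  set z := ⁅u, x⁆ with hz
  -- Both xz and xz⁻¹ are conjugates of x, hence quadratic.
  have h₁ : x * z = u * x * u⁻¹ := by
    rw [← hcx.eq, hz, commutatorElement_def]; group
  have h₃ : x * z⁻¹ = u⁻¹ * x * u⁻¹⁻¹ := by
    have : u * z⁻¹ = z⁻¹ * u := (hcu.inv_left).eq.symm
    have e : x * z⁻¹ = u⁻¹ * (u * (x * z⁻¹)) := by group
    have e' : u * (x * z⁻¹) = z⁻¹ * u * x := by
      rw [← hcx.inv_left.eq, ← mul_assoc, this]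
    rw [e, e', hz, commutatorElement_def]; group
  refine sub_one_sq_eq_zero_of_mul h2 (x := ψ x) (y := ψ x⁻¹) (w := ψ z⁻¹) ?_ ?_ ?_
    (hcx.symm.map ψ) hx ?_ ?_
  · rw [← map_mul]; simp
  · rw [← map_mul]; simp
  · rw [← map_mul]; simp
  · rw [← map_mul, h₁]; exact map_conj_sub_one_pow ψ x u 2 hx
  · rw [← map_mul, h₃]; exact map_conj_sub_one_pow ψ x u⁻¹ 2 hx

/-- If `x ≠ 1` lies in an abelian normal subgroup `M` and in the `(k + 1)`-st centre and
`(x - 1) ^ (d + 1)` vanishes, then `M` has a central element `z ≠ 1` for which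
`(z - 1) ^ (2 ^ k * d + 1)` vanishes. -/
theorem exists_mem_center_sub_one_pow (M : Subgroup G) [M.Normal]
    (hM : ∀ a ∈ M, ∀ b ∈ M, a * b = b * a) (k : ℕ) : ∀ (d : ℕ) (x : G),
    x ∈ Subgroup.upperCentralSeries G (k + 1) → x ∈ M → x ≠ 1 → (ψ x - 1) ^ (d + 1) = 0 →
    ∃ z ∈ Subgroup.center G, z ≠ 1 ∧ (ψ z - 1) ^ (2 ^ k * d + 1) = 0 := by
  induction k with
  | zero =>
    intro d x hx _ h1 hd
    exact ⟨x, by simpa using hx, h1, by simpa using hd⟩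
  | succ k ih =>
    intro d x hx hxM h1 hd
    by_cases hc : x ∈ Subgroup.center G
    · refine ⟨x, hc, h1, pow_eq_zero_of_le ?_ hd⟩
      have := Nat.one_le_two_pow (n := k + 1)
      nlinarith
    · obtain ⟨y, hy⟩ : ∃ y : G, ⁅x, y⁆ ≠ 1 := by
        by_contra! h
        exact hc (Subgroup.mem_center_iff.2 fun g => (commutatorElement_eq_one_iff_mul_comm.1
          (h g)).symm)
      have e : ⁅x, y⁆ = x * (y * x⁻¹ * y⁻¹) := by rw [commutatorElement_def]; group
      have hyM : y * x⁻¹ * y⁻¹ ∈ M := Subgroup.Normal.conj_mem inferInstance _ (M.inv_mem hxM) _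
      have := ih (2 * d) ⁅x, y⁆ (Subgroup.mem_upperCentralSeries_succ_iff.1 hx y)
        (e ▸ M.mul_mem hxM hyM) hy ?_
      · rwa [← mul_assoc, ← pow_succ] at this
      -- The two factors x and y x⁻¹ y⁻¹ lie in the abelian group `M`, and (d + 1) + (d + 1) = (2d +
      -- 1) + 1.
      · rw [e]
        exact map_mul_sub_one_pow ψ (hM _ hxM _ hyM) hd
          (map_conj_sub_one_pow ψ _ _ _ (map_inv_sub_one_pow ψ _ _ hd)) (by omega)

/-- If two elements of a nilpotent group do not commute, some element of the subgroup which they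
generate has a nontrivial commutator with one of them that commutes with both. -/
theorem exists_commutator_ne_one_of_not_commute [Group.IsNilpotent G] {x y : G}
    (hxy : ¬ Commute x y) : ∃ u ∈ Subgroup.closure {x, y}, ∃ t ∈ ({x, y} : Set G),
    ⁅u, t⁆ ≠ 1 ∧ Commute ⁅u, t⁆ u ∧ Commute ⁅u, t⁆ t := by
  classical
  -- With j minimal, ⁅u, t⁆ lies one step lower in ⟨x, y⟩, so it commutes with both generators and
  -- hence with u.
  have hex : ∃ j, ∃ u ∈ Subgroup.closure {x, y}, u ∈ Subgroup.upperCentralSeries G j ∧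
      ∃ t ∈ ({x, y} : Set G), ⁅u, t⁆ ≠ 1 := by
    refine ⟨Group.nilpotencyClass G, x, Subgroup.subset_closure (by simp), ?_, y, by simp, ?_⟩
    · rw [Subgroup.upperCentralSeries_nilpotencyClass]; trivial
    · rwa [Ne, commutatorElement_eq_one_iff_commute]
  obtain ⟨u, hu, huj, t, ht, h1⟩ := Nat.find_spec hex
  obtain ⟨j, hj⟩ : ∃ j, Nat.find hex = j + 1 := by
    refine Nat.exists_eq_succ_of_ne_zero fun h0 => h1 ?_
    rw [h0] at huj
    simp only [Subgroup.upperCentralSeries_zero, Subgroup.mem_bot] at huj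
    simp [huj]
  have htN : t ∈ Subgroup.closure {x, y} := Subgroup.subset_closure ht
  have hzN : ⁅u, t⁆ ∈ Subgroup.closure {x, y} := by
    rw [commutatorElement_def]
    exact mul_mem (mul_mem (mul_mem hu htN) (inv_mem hu)) (inv_mem htN)
  rw [hj] at huj
  have hz := Subgroup.mem_upperCentralSeries_succ_iff.1 huj t
  have hcomm : ∀ s ∈ ({x, y} : Set G), Commute ⁅u, t⁆ s := by
    intro s hs
    by_contra h
    refine Nat.find_min hex (m := j) (by omega) ⟨_, hzN, hz, s, hs, ?_⟩
    rwa [Ne, commutatorElement_eq_one_iff_commute]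
  have hcl : Subgroup.closure {x, y} ≤ Subgroup.centralizer {⁅u, t⁆} := by
    refine (Subgroup.closure_le _).2 fun s hs => ?_
    rw [SetLike.mem_coe, Subgroup.mem_centralizer_singleton_iff]
    exact (hcomm s hs).symm.eq
  refine ⟨u, hu, t, ht, h1, ?_, hcomm t ht⟩
  exact (Subgroup.mem_centralizer_singleton_iff.1 (hcl hu)).symm

/-- In a representation of a nilpotent group of class at most `c`, a nontrivial quadratic element
forces a nontrivial central element `z` with `(z - 1) ^ (2 ^ (c - 1) + 1) = 0`. -/
theorem exists_mem_center_of_quadratic (h2 : ∀ r : R, 2 * r = 0 → r = 0) [Group.IsNilpotent G]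
    {x : G} (hx1 : x ≠ 1) (hx : (ψ x - 1) ^ 2 = 0) :
    ∃ z ∈ Subgroup.center G, z ≠ 1 ∧
      (ψ z - 1) ^ (2 ^ (Group.nilpotencyClass G - 1) + 1) = 0 := by
  classical
  -- Minimality of r forces the conjugates of the chosen x to commute.
  have hex : ∃ r, ∃ x ∈ Subgroup.upperCentralSeries G r, x ≠ 1 ∧ (ψ x - 1) ^ 2 = 0 :=
    ⟨Group.nilpotencyClass G, x, by rw [Subgroup.upperCentralSeries_nilpotencyClass]; trivial, hx1, hx⟩
  have hle : Nat.find hex ≤ Group.nilpotencyClass G := Nat.find_min' hex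
    ⟨x, by rw [Subgroup.upperCentralSeries_nilpotencyClass]; trivial, hx1, hx⟩
  clear hx hx1 x
  obtain ⟨x, hxr, hx1, hx⟩ := Nat.find_spec hex
  obtain ⟨r, hr⟩ : ∃ r, Nat.find hex = r + 1 := by
    refine Nat.exists_eq_succ_of_ne_zero fun h0 => hx1 ?_
    rw [h0] at hxr
    simpa using hxr
  rw [hr] at hxr
  have hconj : ∀ g, g * x * g⁻¹ ∈ Subgroup.upperCentralSeries G (r + 1) := fun g =>
    Subgroup.Normal.conj_mem inferInstance _ hxr g
  have hcomm : ∀ g h : G, Commute (g * x * g⁻¹) (h * x * h⁻¹) := by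
    intro g h
    by_contra hn
    obtain ⟨u, -, t, ht, hz1, hzu, hzt⟩ := exists_commutator_ne_one_of_not_commute hn
    have ht' : t ∈ Subgroup.upperCentralSeries G (r + 1) ∧ (ψ t - 1) ^ 2 = 0 := by
      rcases ht with rfl | rfl
      · exact ⟨hconj g, map_conj_sub_one_pow ψ x g 2 hx⟩
      · exact ⟨hconj h, map_conj_sub_one_pow ψ x h 2 hx⟩
    refine Nat.find_min hex (m := r) (by omega) ⟨⁅u, t⁆, ?_, hz1,
      commutator_sub_one_sq ψ h2 ht'.2 hzu hzt⟩
    rw [← commutatorElement_inv]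
    exact inv_mem (Subgroup.mem_upperCentralSeries_succ_iff.1 ht'.1 u)
  have hM : ∀ a ∈ Subgroup.normalClosure {x}, ∀ b ∈ Subgroup.normalClosure {x},
      a * b = b * a := by
    have := Subgroup.isMulCommutative_closure (k := Group.conjugatesOfSet {x}) (by
      intro a ha b hb
      simp only [Group.mem_conjugatesOfSet_iff, Set.mem_singleton_iff, exists_eq_left,
        isConj_iff] at ha hb
      obtain ⟨g, rfl⟩ := ha
      obtain ⟨h, rfl⟩ := hb
      exact hcomm g h)
    intro a ha b hb
    exact congrArg Subtype.val (this.is_comm.comm ⟨a, ha⟩ ⟨b, hb⟩)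
  obtain ⟨z, hz, hz1, h⟩ := exists_mem_center_sub_one_pow ψ _ hM r 1 x hxr
    (Subgroup.subset_normalClosure rfl) hx1 hx
  refine ⟨z, hz, hz1, pow_eq_zero_of_le ?_ h⟩
  have := Nat.pow_le_pow_right (n := 2) (by norm_num)
    (show r ≤ Group.nilpotencyClass G - 1 by omega)
  omega

end Representation

/-! ### Replacement for abelian groups of unipotent operators -/

section Replacement

variable {G V : Type*} [Group G] [AddCommGroup V] (ψ : G →* AddMonoid.End V)

theorem addEnd_map_mul_apply (a b : G) (v : V) : ψ (a * b) v = ψ a (ψ b v) := by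
  rw [map_mul]; rfl

/-- The additive subgroup of vectors fixed by the subgroup `A`. -/
def fixedAddSubgroup (A : Subgroup G) : AddSubgroup V where
  carrier := {v | ∀ a ∈ A, ψ a v = v}
  zero_mem' := fun a _ => map_zero _
  add_mem' := fun hu hv a ha => by rw [map_add, hu a ha, hv a ha]
  neg_mem' := fun hu a ha => by rw [map_neg, hu a ha]

theorem fixedAddSubgroup_anti {A B : Subgroup G} (h : B ≤ A) :
    fixedAddSubgroup ψ A ≤ fixedAddSubgroup ψ B := fun _ hv a ha => hv a (h ha)

/-- The centralizer in `A` of `[v, A]`. -/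
def commutatorStabilizer (A : Subgroup G) (v : V) : Subgroup G where
  carrier := {a | a ∈ A ∧ ∀ t ∈ A, ψ a (ψ t v - v) = ψ t v - v}
  one_mem' := ⟨A.one_mem, fun t _ => by rw [map_one]; rfl⟩
  mul_mem' := fun ha hb => ⟨A.mul_mem ha.1 hb.1, fun t ht => by
    rw [addEnd_map_mul_apply, hb.2 t ht, ha.2 t ht]⟩
  inv_mem' := fun {a} ha => ⟨A.inv_mem ha.1, fun t ht => by
    nth_rewrite 1 [← ha.2 t ht]
    rw [← addEnd_map_mul_apply]; simp⟩

theorem commutatorStabilizer_le (A : Subgroup G) (v : V) : commutatorStabilizer ψ A v ≤ A :=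
  fun _ h => h.1

variable {ψ}

/-- As A is abelian, (t - 1)(a - b)v = (a - b)(t - 1)v for t in A: if t fixes (a - b)v, then a and b
agree on (t - 1)v. -/
theorem inv_mul_mem_commutatorStabilizer {A : Subgroup G} (hA : ∀ a ∈ A, ∀ b ∈ A, a * b = b * a)
    {v : V} {a b : G} (ha : a ∈ A) (hb : b ∈ A)
    (h : (ψ a v - v) - (ψ b v - v) ∈ fixedAddSubgroup ψ A) :
    a⁻¹ * b ∈ commutatorStabilizer ψ A v := by
  refine ⟨A.mul_mem (A.inv_mem ha) hb, fun t ht => ?_⟩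
  have h₁ := h t ht
  have hta : ψ t (ψ a v) = ψ a (ψ t v) := by
    rw [← addEnd_map_mul_apply, ← addEnd_map_mul_apply, hA t ht a ha]
  have htb : ψ t (ψ b v) = ψ b (ψ t v) := by
    rw [← addEnd_map_mul_apply, ← addEnd_map_mul_apply, hA t ht b hb]
  have h₂ : ψ b (ψ t v - v) = ψ a (ψ t v - v) := by
    simp only [map_sub, hta, htb] at h₁ ⊢
    have h₃ : ψ a (ψ t v) - ψ t v - (ψ b (ψ t v) - ψ t v) - (ψ a v - v - (ψ b v - v)) = 0 :=
      sub_eq_zero.2 h₁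
    rw [← sub_eq_zero, ← neg_eq_zero, ← h₃]; abel
  rw [addEnd_map_mul_apply, h₂, ← addEnd_map_mul_apply]; simp

/-- With B the stabilizer, a ↦ (a - 1)v embeds A/B into C_V(B)/C_V(A). Hence passing from A to B
preserves the hypothesis of the replacement argument. -/
theorem card_mul_card_fixedAddSubgroup_le [Finite G] [Finite V] {A : Subgroup G}
    (hA : ∀ a ∈ A, ∀ b ∈ A, a * b = b * a) (v : V) :
    Nat.card A * Nat.card (fixedAddSubgroup ψ A) ≤
      Nat.card (commutatorStabilizer ψ A v) *
        Nat.card (fixedAddSubgroup ψ (commutatorStabilizer ψ A v)) := by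
  set B := commutatorStabilizer ψ A v with hB
  set C := fixedAddSubgroup ψ A with hC
  set D := fixedAddSubgroup ψ B with hD
  have hBA : B ≤ A := commutatorStabilizer_le ψ A v
  have hCD : C ≤ D := fixedAddSubgroup_anti ψ hBA
  have hmem : ∀ a ∈ A, ψ a v - v ∈ D := fun a ha b hb => hb.2 a ha
  let f : A ⧸ B.subgroupOf A → D ⧸ C.addSubgroupOf D := fun q =>
    QuotientAddGroup.mk ⟨ψ q.out v - v, hmem _ q.out.2⟩
  have hf : Function.Injective f := by
    intro q r hqr
    have h := QuotientAddGroup.eq.1 hqr.symm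
    rw [AddSubgroup.mem_addSubgroupOf] at h
    rw [← QuotientGroup.out_eq' q, ← QuotientGroup.out_eq' r, QuotientGroup.eq,
      Subgroup.mem_subgroupOf]
    refine inv_mul_mem_commutatorStabilizer hA q.out.2 r.out.2 ?_
    have e : ψ q.out v - v - (ψ r.out v - v) = -(ψ r.out v - v) + (ψ q.out v - v) := by abel
    rw [e]; exact h
  have h₁ : Nat.card B * B.relIndex A = Nat.card A := by
    rw [← Subgroup.relIndex_bot_left, Subgroup.relIndex_mul_relIndex _ _ _ bot_le hBA,
      Subgroup.relIndex_bot_left]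
  have h₂ : Nat.card C * C.relIndex D = Nat.card D := by
    rw [← AddSubgroup.relIndex_bot_left, AddSubgroup.relIndex_mul_relIndex _ _ _ bot_le hCD,
      AddSubgroup.relIndex_bot_left]
  have h₃ : B.relIndex A ≤ C.relIndex D := Nat.card_le_card_of_injective f hf
  rw [← h₁, ← h₂, mul_assoc, mul_comm (B.relIndex A)]
  gcongr

/-- Now a ↦ (a - 1)v embeds A into V/C_V(A), and `hcard` makes this a bijection. So v ≡ (a - 1)v
modulo C_V(A) for some a; applying t - 1 shows that (t - 1)v is fixed by the nilpotent operator a -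
1, hence is zero. -/
theorem map_apply_eq_self_of_commutatorStabilizer_eq_bot [Finite G] [Finite V] {A : Subgroup G}
    (hA : ∀ a ∈ A, ∀ b ∈ A, a * b = b * a) (hnil : ∀ a ∈ A, IsNilpotent (ψ a - 1))
    (hcard : Nat.card V ≤ Nat.card A * Nat.card (fixedAddSubgroup ψ A)) {v : V}
    (hv : commutatorStabilizer ψ A v = ⊥) {t : G} (ht : t ∈ A) : ψ t v = v := by
  let f : A → V ⧸ fixedAddSubgroup ψ A := fun a => QuotientAddGroup.mk (ψ a v - v)
  have hf : Function.Injective f := by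
    intro a b hab
    have h := QuotientAddGroup.eq.1 hab.symm
    have := inv_mul_mem_commutatorStabilizer hA a.2 b.2 (v := v) (ψ := ψ) (by
      rw [show ψ a v - v - (ψ b v - v) = -(ψ b v - v) + (ψ a v - v) by abel]; exact h)
    rw [hv, Subgroup.mem_bot, inv_mul_eq_one] at this
    exact Subtype.ext this
  have hle : Nat.card (V ⧸ fixedAddSubgroup ψ A) ≤ Nat.card A := by
    rw [AddSubgroup.card_eq_card_quotient_mul_card_addSubgroup (fixedAddSubgroup ψ A)] at hcard
    exact Nat.le_of_mul_le_mul_right hcard Nat.card_pos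
  obtain ⟨⟨a, ha⟩, hav⟩ := (hf.bijective_of_nat_card_le hle).2 (QuotientAddGroup.mk v)
  have h := QuotientAddGroup.eq.1 hav t ht
  have hta : ψ t (ψ a v) = ψ a (ψ t v) := by
    rw [← addEnd_map_mul_apply, ← addEnd_map_mul_apply, hA t ht a ha]
  have hfix : (ψ a - 1) (ψ t v - v) = ψ t v - v := by
    change ψ a (ψ t v - v) - (ψ t v - v) = ψ t v - v
    simp only [map_add, map_neg, map_sub, hta] at h ⊢
    rw [← sub_eq_zero] at h ⊢
    rw [← neg_eq_zero, ← h]; abel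
  obtain ⟨n, hn⟩ := hnil a ha
  have hpow : ∀ m : ℕ, ((ψ a - 1) ^ m) (ψ t v - v) = ψ t v - v := by
    intro m
    induction m with
    | zero => rfl
    | succ m ih =>
      rw [pow_succ]
      change ((ψ a - 1) ^ m) ((ψ a - 1) (ψ t v - v)) = _
      rw [hfix, ih]
  have := hpow n
  rw [hn] at this
  exact sub_eq_zero.1 this.symm

/-- Replacement: a nontrivial abelian group `A` of unipotent operators on a abelian group `V` with `|V| ≤ |A| |C_V(A)|` has a nontrivial quadratic element. -/
theorem exists_quadratic_of_card_le [Finite G] [Finite V] (hnil : ∀ g, IsNilpotent (ψ g - 1)) (n : ℕ) : ∀ A : Subgroup G, Nat.card A = n → A ≠ ⊥ →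
    (∀ a ∈ A, ∀ b ∈ A, a * b = b * a) →
    Nat.card V ≤ Nat.card A * Nat.card (fixedAddSubgroup ψ A) →
    ∃ a, a ≠ 1 ∧ (ψ a - 1) ^ 2 = 0 := by
  induction n using Nat.strong_induction_on with
  | _ n ih =>
    intro A hn hA1 hA hcard
    obtain ⟨⟨a, haA⟩, ha1⟩ := (Subgroup.ne_bot_iff_exists_ne_one (H := A)).1 hA1
    -- If no v gives a proper stabilizer, every element of A is quadratic; otherwise descend to a
    -- proper stabilizer, which cannot be trivial.
    by_cases hB : ∀ v : V, commutatorStabilizer ψ A v = A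
    · refine ⟨a, by simpa using ha1, AddMonoidHom.ext fun v => ?_⟩
      have hav : (a : G) ∈ commutatorStabilizer ψ A v := by rw [hB v]; exact haA
      rw [sq]
      change ψ a (ψ a v - v) - (ψ a v - v) = 0
      rw [hav.2 a haA, sub_self]
    · push Not at hB
      obtain ⟨v, hv⟩ := hB
      have hle := commutatorStabilizer_le ψ A v
      by_cases hbot : commutatorStabilizer ψ A v = ⊥
      · refine absurd (le_antisymm hle fun b hb => ⟨hb, fun t ht => ?_⟩) hv
        rw [map_apply_eq_self_of_commutatorStabilizer_eq_bot hA (fun a _ => hnil a) hcard hbot ht,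
          sub_self, map_zero]
      · refine ih _ ?_ _ rfl hbot (fun a ha b hb => hA a (hle ha) b (hle hb))
          (hcard.trans (card_mul_card_fixedAddSubgroup_le hA v))
        rw [← hn]
        refine lt_of_le_of_ne (Subgroup.card_le_of_le hle) fun h => hv ?_
        exact Subgroup.eq_of_le_of_card_ge hle h.ge

end Replacement

open scoped commutatorElement

/-! ### Central elements and orders of products -/

section GroupTheory

variable {G : Type*} [Group G]

theorem exists_mem_center_of_normal_ne_bot [Group.IsNilpotent G] (M : Subgroup G) [M.Normal]
    (hM : M ≠ ⊥) : ∃ z ∈ M, z ∈ Subgroup.center G ∧ z ≠ 1 := by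
  obtain ⟨⟨x, hxM⟩, hx1⟩ := (Subgroup.ne_bot_iff_exists_ne_one (H := M)).1 hM
  have key : ∀ (k : ℕ) (x : G), x ∈ Subgroup.upperCentralSeries G k → x ∈ M → x ≠ 1 →
      ∃ z ∈ M, z ∈ Subgroup.center G ∧ z ≠ 1 := by
    intro k
    induction k with
    | zero => intro x hx _ h1; exact absurd (by simpa using hx) h1
    | succ k ih =>
      intro x hx hxM h1
      by_cases hc : x ∈ Subgroup.center G
      · exact ⟨x, hxM, hc, h1⟩
      · obtain ⟨y, hy⟩ : ∃ y : G, ⁅x, y⁆ ≠ 1 := by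
          by_contra! h
          exact hc (Subgroup.mem_center_iff.2 fun g => (commutatorElement_eq_one_iff_mul_comm.1
            (h g)).symm)
        have e : ⁅x, y⁆ = x * (y * x⁻¹ * y⁻¹) := by rw [commutatorElement_def]; group
        refine ih ⁅x, y⁆ (Subgroup.mem_upperCentralSeries_succ_iff.1 hx y) (e ▸ ?_) hy
        exact M.mul_mem hxM (Subgroup.Normal.conj_mem inferInstance _ (M.inv_mem hxM) _)
  exact key _ x (by rw [Subgroup.upperCentralSeries_nilpotencyClass]; trivial) hxM
    (by simpa using hx1)

theorem iterCommutator_eq_bot_of_le {A B : Subgroup G} {m n : ℕ} (hmn : m ≤ n)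
    (h : iterCommutator A B m = ⊥) : iterCommutator A B n = ⊥ := by
  induction n, hmn using Nat.le_induction with
  | base => exact h
  | succ n _ ih => rw [iterCommutator, ih, Subgroup.commutator_bot_left]

/-- If `|V (A ∩ X)| ≤ |A|` then `|V| ≤ |A X / X| |V ∩ A ∩ X|`. -/
theorem card_le_card_map_mk_mul_card_inf [Finite G] (X V A : Subgroup G) [X.Normal] [V.Normal]
    (h : Nat.card (A ⊓ X ⊔ V : Subgroup G) ≤ Nat.card A) :
    Nat.card V ≤ Nat.card (A.map (QuotientGroup.mk' X)) * Nat.card (V ⊓ (A ⊓ X) : Subgroup G) := by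
  have card_rel : ∀ {H K : Subgroup G}, H ≤ K → Nat.card H * H.relIndex K = Nat.card K := by
    intro H K hHK
    rw [← Subgroup.relIndex_bot_left, Subgroup.relIndex_mul_relIndex _ _ _ bot_le hHK,
      Subgroup.relIndex_bot_left]
  have h₁ : Nat.card V * V.relIndex (A ⊓ X) = Nat.card (A ⊓ X ⊔ V : Subgroup G) := by
    rw [← Subgroup.relIndex_sup_right]
    exact card_rel le_sup_right
  have h₂ : Nat.card (V ⊓ (A ⊓ X) : Subgroup G) * V.relIndex (A ⊓ X) =
      Nat.card (A ⊓ X : Subgroup G) := by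
    rw [← Subgroup.inf_relIndex_right V]
    exact card_rel inf_le_right
  have h₃ : Nat.card (A ⊓ X : Subgroup G) * Nat.card (A.map (QuotientGroup.mk' X)) =
      Nat.card A := by
    rw [← Subgroup.relIndex_ker, QuotientGroup.ker_mk', ← Subgroup.inf_relIndex_left]
    exact card_rel inf_le_left
  -- The index of V ∩ A ∩ X in A ∩ X is the common factor to be cancelled.
  have hpos : 0 < V.relIndex (A ⊓ X) := Nat.pos_of_ne_zero fun h0 => by
    rw [h0, mul_zero] at h₂
    exact Nat.card_pos.ne h₂
  refine Nat.le_of_mul_le_mul_right ?_ hpos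
  calc _ ≤ Nat.card A := h₁ ▸ h
    _ = _ := by rw [← h₃, ← h₂]; ring

end GroupTheory

/-! ### The action of the quotient on an abelian normal subgroup -/

section Conjugation

variable {S : Type*} [Group S] (X V : Subgroup S) [X.Normal] [V.Normal] [hV : IsMulCommutative V]

open scoped IsMulCommutative

/-- The conjugation action on an abelian normal subgroup, written additively. -/
def conjAddEnd : S →* AddMonoid.End (Additive V) where
  toFun g := MonoidHom.toAdditive (MulAut.conjNormal (H := V) g).toMonoidHom
  map_one' := by
    refine AddMonoidHom.ext fun v => ?_
    change Additive.ofMul (MulAut.conjNormal (H := V) 1 v.toMul) = v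
    rw [map_one]; rfl
  map_mul' a b := by
    refine AddMonoidHom.ext fun v => ?_
    change Additive.ofMul (MulAut.conjNormal (H := V) (a * b) v.toMul) = _
    rw [map_mul]; rfl

theorem coe_conjAddEnd (g : S) (v : Additive V) :
    ((conjAddEnd V g v).toMul : S) = g * v.toMul * g⁻¹ := MulAut.conjNormal_apply g _

/-- The conjugation action of `S ⧸ X` on an abelian normal subgroup centralized by `X`. -/
def quotientConjAddEnd (h : V ≤ Subgroup.centralizer (X : Set S)) :
    S ⧸ X →* AddMonoid.End (Additive V) :=
  QuotientGroup.lift X (conjAddEnd V) fun x hx => AddMonoidHom.ext fun v => by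
    apply Additive.toMul.injective
    apply Subtype.ext
    refine (coe_conjAddEnd V x v).trans ?_
    rw [Subgroup.mem_centralizer_iff.1 (h v.toMul.2) x hx, mul_inv_cancel_right]
    rfl

variable {X V}

theorem coe_quotientConjAddEnd (h : V ≤ Subgroup.centralizer (X : Set S)) (g : S)
    (v : Additive V) : ((quotientConjAddEnd X V h (g : S ⧸ X) v).toMul : S) =
      g * v.toMul * g⁻¹ := coe_conjAddEnd V g v

/-- Elements over ⟨z⟩ act as powers of z, and z^i - 1 is a multiple of z - 1, so each commutator
contributes a factor z - 1. This turns (z - 1)^n = 0 into triviality of the iterated commutator. -/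
theorem exists_eq_of_mem_iterCommutator [Finite S] (h : V ≤ Subgroup.centralizer (X : Set S))
    (z : S ⧸ X) (n : ℕ) : ∀ u ∈ iterCommutator V
      ((Subgroup.zpowers z).comap (QuotientGroup.mk' X)) n,
      ∃ v, u = (((quotientConjAddEnd X V h z - 1) ^ n) v).toMul := by
  set ψ := quotientConjAddEnd X V h with hψ
  let W : ℕ → Subgroup S := fun n =>
    { carrier := {u | ∃ v, u = (((ψ z - 1) ^ n) v).toMul}
      one_mem' := ⟨0, by rw [map_zero]; rfl⟩
      mul_mem' := by
        rintro _ _ ⟨v, rfl⟩ ⟨w, rfl⟩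
        exact ⟨v + w, by rw [map_add]; rfl⟩
      inv_mem' := by
        rintro _ ⟨v, rfl⟩
        exact ⟨-v, by rw [map_neg]; rfl⟩ }
  change iterCommutator V _ n ≤ W n
  induction n with
  | zero => exact fun u hu => ⟨Additive.ofMul ⟨u, hu⟩, rfl⟩
  | succ n ih =>
    refine Subgroup.commutator_le.2 fun u hu g hg => ?_
    obtain ⟨v, rfl⟩ := ih hu
    -- Finiteness allows a natural exponent, as the geometric sum requires.
    obtain ⟨i, hi⟩ := mem_powers_iff_mem_zpowers.2 (Subgroup.mem_comap.1 hg)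
    have hi' : (g : S ⧸ X) = z ^ i := hi.symm
    set q : AddMonoid.End (Additive V) := ∑ j ∈ Finset.range i, ψ z ^ j
    have hq : ψ (g : S ⧸ X) - 1 = (ψ z - 1) * q := by
      rw [mul_geom_sum, hi', map_pow]
    have hc : Commute (ψ z - 1) q :=
      Commute.sum_right _ _ _ fun j _ =>
        (Commute.sub_left (Commute.pow_right (Commute.refl _) j) (Commute.one_left _))
    refine ⟨-(q v), ?_⟩
    have e : ((ψ z - 1) ^ (n + 1)) (-(q v)) =
        ((ψ z - 1) ^ n) v - ψ (g : S ⧸ X) (((ψ z - 1) ^ n) v) := by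
      have : (ψ z - 1) ^ (n + 1) * q = (ψ (g : S ⧸ X) - 1) * (ψ z - 1) ^ n := by
        rw [hq, (hc.pow_left (n + 1)).eq, pow_succ', ← mul_assoc, hc.eq]
      rw [map_neg]
      change -(((ψ z - 1) ^ (n + 1) * q) v) = _
      rw [this]
      change -(ψ (g : S ⧸ X) (((ψ z - 1) ^ n) v) - ((ψ z - 1) ^ n) v) = _
      abel
    rw [e]
    generalize ((ψ z - 1) ^ n) v = w
    change _ = (w.toMul : S) / ((ψ (g : S ⧸ X) w).toMul : S)
    rw [coe_quotientConjAddEnd, commutatorElement_def, div_eq_mul_inv]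
    group

end Conjugation

/-! ### Properties of the Oliver subgroup -/

section Oliver

variable {S : Type*} [Group S] {p : ℕ}

/-- A normal subgroup properly containing the Oliver subgroup does not extend an Oliver series. -/
theorem iterCommutator_comap_zpowers_ne_bot [Finite S] {z : S ⧸ oliverSubgroup p S}
    (hz : z ∈ Subgroup.center (S ⧸ oliverSubgroup p S)) (hz1 : z ≠ 1) :
    iterCommutator (omegaOne p (Subgroup.centralizer (oliverSubgroup p S : Set S)))
      ((Subgroup.zpowers z).comap (QuotientGroup.mk' (oliverSubgroup p S))) (p - 1) ≠ ⊥ := by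
  intro h
  have hN : (Subgroup.zpowers z).Normal := by
    refine ⟨fun a ha g => ?_⟩
    obtain ⟨i, rfl⟩ := ha
    have : g * z ^ i = z ^ i * g := Subgroup.mem_center_iff.1 (Subgroup.zpow_mem _ hz i) g
    simp only [this, mul_inv_cancel_right]
    exact ⟨i, rfl⟩
  have hle : oliverSubgroup p S ≤ (Subgroup.zpowers z).comap (QuotientGroup.mk' (oliverSubgroup p S)) := fun x hx => by
    rw [Subgroup.mem_comap, QuotientGroup.mk'_apply, (QuotientGroup.eq_one_iff x).2 hx]
    exact one_mem _
  have hser := HasOliverSeries.step (isGreatest_oliverSubgroup p S).1 (hN.comap _) hle h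
  have hge := (isGreatest_oliverSubgroup p S).2 hser
  obtain ⟨g, rfl⟩ := QuotientGroup.mk_surjective z
  exact hz1 ((QuotientGroup.eq_one_iff g).2 (hge (Subgroup.mem_zpowers (g : S ⧸ oliverSubgroup p S))))

-- Otherwise some c in C = C_S(X) maps to a central z ≠ 1 of S/X. Centrality gives [Ω₁(C), X⟨c⟩] ≤ C
-- ∩ X, which X and c both centralize. Two commutators therefore suffice, and 2 ≤ p - 1 contradicts
-- maximality of X.
open scoped commutatorElement in
theorem centralizer_oliverSubgroup_le [Finite S] [Fact p.Prime] (hodd : Odd p) (hS : IsPGroup p S) :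
    Subgroup.centralizer (oliverSubgroup p S : Set S) ≤ oliverSubgroup p S := by
  set X := oliverSubgroup p S with hX
  set C := Subgroup.centralizer (X : Set S) with hC
  have hCn : C.Normal := Subgroup.normal_centralizer
  have hnil : Group.IsNilpotent (S ⧸ X) := (hS.to_quotient X).isNilpotent
  by_contra hnot
  have hM : C.map (QuotientGroup.mk' X) ≠ ⊥ := by
    rwa [Ne, Subgroup.map_eq_bot_iff, QuotientGroup.ker_mk']
  have hMn : (C.map (QuotientGroup.mk' X)).Normal :=
    hCn.map _ (QuotientGroup.mk'_surjective X)
  obtain ⟨z, ⟨c, hc, hcz⟩, hz, hz1⟩ := exists_mem_center_of_normal_ne_bot _ hM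
  have hp3 : 2 ≤ p - 1 := by
    have := (Fact.out : p.Prime).two_le
    obtain ⟨m, rfl⟩ := hodd
    omega
  refine iterCommutator_comap_zpowers_ne_bot hz hz1 (iterCommutator_eq_bot_of_le hp3 ?_)
  have h₁ : iterCommutator (omegaOne p C)
      ((Subgroup.zpowers z).comap (QuotientGroup.mk' X)) 1 ≤ C ⊓ X := by
    refine Subgroup.commutator_le.2 fun u hu g hg => ⟨?_, ?_⟩
    · have e : ⁅u, g⁆ = u * (g * u⁻¹ * g⁻¹) := by rw [commutatorElement_def]; group
      have huC : u ∈ C := omegaOne_le p C hu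
      rw [e]
      exact C.mul_mem huC (hCn.conj_mem _ (C.inv_mem huC) g)
    · obtain ⟨i, hi⟩ := Subgroup.mem_comap.1 hg
      have hgc : QuotientGroup.mk' X g ∈ Subgroup.center (S ⧸ X) :=
        hi ▸ Subgroup.zpow_mem _ hz i
      have : QuotientGroup.mk' X ⁅u, g⁆ = 1 := by
        rw [map_commutatorElement, commutatorElement_eq_one_iff_mul_comm]
        exact Subgroup.mem_center_iff.1 hgc _
      exact (QuotientGroup.eq_one_iff _).1 this
  rw [eq_bot_iff]
  refine Subgroup.commutator_le.2 fun u hu g hg => ?_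
  obtain ⟨huC, huX⟩ := h₁ hu
  obtain ⟨i, hi⟩ := Subgroup.mem_comap.1 hg
  have hx : (c ^ i)⁻¹ * g ∈ X := by
    rw [← QuotientGroup.eq]
    change QuotientGroup.mk' X (c ^ i) = QuotientGroup.mk' X g
    rw [map_zpow, hcz, ← hi]
  have hc₁ : Commute u (c ^ i) := Subgroup.mem_centralizer_iff.1 (C.zpow_mem hc i) u huX
  have hc₂ : Commute u ((c ^ i)⁻¹ * g) := (Subgroup.mem_centralizer_iff.1 huC _ hx).symm
  have hc₃ : Commute u g := by simpa using hc₁.mul_right hc₂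
  rw [Subgroup.mem_bot, commutatorElement_eq_one_iff_commute]
  exact hc₃

theorem isMulCommutative_omegaOne_centralizer {X : Subgroup S}
    (hX : Subgroup.centralizer (X : Set S) ≤ X) :
    IsMulCommutative (omegaOne p (Subgroup.centralizer (X : Set S))) :=
  ⟨⟨fun a b => Subtype.ext (Subgroup.mem_centralizer_iff.1 (omegaOne_le p _ b.2) a
    (hX (omegaOne_le p _ a.2)))⟩⟩

theorem pow_eq_one_of_mem_omegaOne {H : Subgroup S} [hH : IsMulCommutative (omegaOne p H)]
    {x : S} (hx : x ∈ omegaOne p H) : x ^ p = 1 := by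
  induction hx using Subgroup.closure_induction with
  | mem x hx => exact hx.2
  | one => exact one_pow p
  | mul x y hx hy ihx ihy =>
    have : Commute x y := congrArg Subtype.val (hH.is_comm.comm ⟨x, hx⟩ ⟨y, hy⟩)
    rw [this.mul_pow, ihx, ihy, one_mul]
  | inv x _ ih => rw [inv_pow, ih, inv_one]

theorem isElementaryAbelian_inf_sup_omegaOne {X A : Subgroup S}
    (hX : Subgroup.centralizer (X : Set S) ≤ X) (hA : IsElementaryAbelian p A) [X.Normal] :
    IsElementaryAbelian p (A ⊓ X ⊔ omegaOne p (Subgroup.centralizer (X : Set S))) := by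
  have hV := isMulCommutative_omegaOne_centralizer (p := p) hX
  have hCn : (Subgroup.centralizer (X : Set S)).Normal := Subgroup.normal_centralizer
  have hle := omegaOne_le p (Subgroup.centralizer (X : Set S))
  have hcomm : ∀ x ∈ X, ∀ v ∈ omegaOne p (Subgroup.centralizer (X : Set S)), Commute x v :=
    fun x hx v hv => Subgroup.mem_centralizer_iff.1 (hle hv) x hx
  constructor
  · intro a ha b hb
    obtain ⟨x, hx, v, hv, rfl⟩ := Subgroup.mem_sup_of_normal_right.1 ha
    obtain ⟨y, hy, w, hw, rfl⟩ := Subgroup.mem_sup_of_normal_right.1 hb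
    have hxy : Commute x y := hA.1 x hx.1 y hy.1
    exact ((hxy.mul_right (hcomm x hx.2 w hw)).mul_left
      ((hcomm y hy.2 v hv).symm.mul_right (hcomm v (hX (hle hv)) w hw))).eq
  · intro a ha
    obtain ⟨x, hx, v, hv, rfl⟩ := Subgroup.mem_sup_of_normal_right.1 ha
    rw [(hcomm x hx.2 v hv).mul_pow, hA.2 x hx.1, pow_eq_one_of_mem_omegaOne hv, one_mul]

end Oliver

/-! ### Characteristic p, the class bound and the conclusion -/

theorem sub_one_pow_prime_pow_eq_zero {R : Type*} [Ring R] {p : ℕ} (hp : p.Prime)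
    (hR : (p : R) = 0) {x : R} {n : ℕ} (hx : x ^ p ^ n = 1) : (x - 1) ^ p ^ n = 0 := by
  rcases subsingleton_or_nontrivial R with h | h
  · exact Subsingleton.elim _ _
  · have : Fact p.Prime := ⟨hp⟩
    have : CharP R p := (CharP.ringChar_of_prime_eq_zero hp hR) ▸ ringChar.charP R
    rw [sub_pow_char_pow_of_commute p n (Commute.one_right x), hx, one_pow, sub_self]

theorem two_pow_add_one_le_of_le_logb {p c : ℕ} (hp : 3 ≤ p) (hc : 1 ≤ c)
    (h : (c : ℝ) ≤ Real.logb 2 ((p : ℝ) - 2) + 1) : 2 ^ (c - 1) + 1 ≤ p - 1 := by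
  have hp' : (3 : ℝ) ≤ p := by exact_mod_cast hp
  have h₁ : ((c - 1 : ℕ) : ℝ) ≤ Real.logb 2 ((p : ℝ) - 2) := by
    rw [Nat.cast_sub hc, Nat.cast_one]; linarith
  rw [Real.le_logb_iff_rpow_le one_lt_two (by linarith), Real.rpow_natCast] at h₁
  have h₂ : 2 ^ (c - 1) + 2 ≤ p := by
    have : (2 : ℝ) ^ (c - 1) + 2 ≤ p := by linarith
    exact_mod_cast this
  omega

open scoped IsMulCommutative in
/-- If every nontrivial central element `z` of `S / X` satisfies `[V, X⟨z⟩; p - 1] ≠ 1` and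
`S / X` has small nilpotency class, then an elementary abelian subgroup `A` for which
`|V (A ∩ X)| ≤ |A|` is contained in `X`. -/
theorem IsElementaryAbelian.le_of_iterCommutator_ne_bot {p : ℕ} (hp : p.Prime) (hp3 : 3 ≤ p)
    (hodd : Odd p) {S : Type*} [Group S] [Finite S] (hS : IsPGroup p S) {X V A : Subgroup S}
    [X.Normal] [V.Normal] [IsMulCommutative V] (hVX : V ≤ Subgroup.centralizer (X : Set S))
    (hpow : ∀ x ∈ V, x ^ p = 1)
    (hne : ∀ z ∈ Subgroup.center (S ⧸ X), z ≠ 1 →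
      iterCommutator V ((Subgroup.zpowers z).comap (QuotientGroup.mk' X)) (p - 1) ≠ ⊥)
    (hclass : (Group.nilpotencyClass (S ⧸ X) : ℝ) ≤ Real.logb 2 ((p : ℝ) - 2) + 1)
    (hA : IsElementaryAbelian p A) (hcard : Nat.card (A ⊓ X ⊔ V : Subgroup S) ≤ Nat.card A) :
    A ≤ X := by
  by_contra hAX
  have : Fact p.Prime := ⟨hp⟩
  have hG : IsPGroup p (S ⧸ X) := hS.to_quotient X
  have hnilG : Group.IsNilpotent (S ⧸ X) := hG.isNilpotent
  have hfin : Finite (Additive V) := inferInstanceAs (Finite V)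
  set ψ := quotientConjAddEnd X V hVX with hψ
  have hne' : ∀ z ∈ Subgroup.center (S ⧸ X), z ≠ 1 → (ψ z - 1) ^ (p - 1) ≠ 0 := by
    intro z hz hz1 h
    refine hne z hz hz1 (eq_bot_iff.2 fun u hu => ?_)
    obtain ⟨v, rfl⟩ := exists_eq_of_mem_iterCommutator hVX z (p - 1) u hu
    rw [← hψ, h]
    exact Subgroup.mem_bot.2 rfl
  have hR : ∀ r : AddMonoid.End (Additive V), (p : AddMonoid.End (Additive V)) * r = 0 := by
    intro r
    refine AddMonoidHom.ext fun v => Additive.toMul.injective (Subtype.ext ?_)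
    exact hpow _ (r v).toMul.2
  have hp0 : (p : AddMonoid.End (Additive V)) = 0 := by simpa using hR 1
  have h2 : ∀ r : AddMonoid.End (Additive V), 2 * r = 0 → r = 0 := by
    intro r hr
    obtain ⟨m, hm⟩ := hodd
    have h : (p : AddMonoid.End (Additive V)) * r = m * (2 * r) + r := by
      rw [hm]; push_cast; noncomm_ring
    rw [hR, hr, mul_zero, zero_add] at h
    exact h.symm
  have hnil : ∀ g, IsNilpotent (ψ g - 1) := by
    intro g
    obtain ⟨k, hk⟩ := hG g
    exact ⟨p ^ k, sub_one_pow_prime_pow_eq_zero hp hp0 (by rw [← map_pow, hk, map_one])⟩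
  have hE : A.map (QuotientGroup.mk' X) ≠ ⊥ := by
    rwa [Ne, Subgroup.map_eq_bot_iff, QuotientGroup.ker_mk']
  have hEcomm : ∀ a ∈ A.map (QuotientGroup.mk' X), ∀ b ∈ A.map (QuotientGroup.mk' X),
      a * b = b * a := by
    rintro _ ⟨a, ha, rfl⟩ _ ⟨b, hb, rfl⟩
    rw [← map_mul, hA.1 a ha b hb, map_mul]
  have hfix : Nat.card (V ⊓ (A ⊓ X) : Subgroup S) ≤
      Nat.card (fixedAddSubgroup ψ (A.map (QuotientGroup.mk' X))) := by
    refine Nat.card_le_card_of_injective (fun v => ⟨Additive.ofMul ⟨v.1, v.2.1⟩, ?_⟩) ?_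
    · rintro _ ⟨a, ha, rfl⟩
      refine Additive.toMul.injective (Subtype.ext ?_)
      refine (coe_quotientConjAddEnd hVX a _).trans ?_
      change a * v.1 * a⁻¹ = v.1
      rw [hA.1 a ha v.1 v.2.2.1, mul_inv_cancel_right]
    · intro v w h
      exact Subtype.ext (congrArg (fun u : V => (u : S)) (congrArg Subtype.val h))
  obtain ⟨x, hx1, hx⟩ := exists_quadratic_of_card_le hnil _ _ rfl hE hEcomm
    ((card_le_card_map_mk_mul_card_inf X V A hcard).trans (Nat.mul_le_mul_left _ hfix))
  obtain ⟨z, hz, hz1, h⟩ := exists_mem_center_of_quadratic ψ h2 hx1 hx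
  -- The element x ≠ 1 excludes class 0, where the natural subtraction c - 1 would truncate.
  have hc : 1 ≤ Group.nilpotencyClass (S ⧸ X) := by
    refine Nat.one_le_iff_ne_zero.2 fun h0 => hx1 ?_
    have := Subgroup.upperCentralSeries_nilpotencyClass (G := S ⧸ X)
    rw [h0, Subgroup.upperCentralSeries_zero] at this
    exact Subgroup.mem_bot.1 (this ▸ Subgroup.mem_top x)
  exact hne' z hz hz1 (pow_eq_zero_of_le (two_pow_add_one_le_of_le_logb hp3 hc hclass) h)

theorem mainTheorem1 {p : ℕ} (hp : p.Prime) (hodd : Odd p)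
    {S : Type*} [Group S] [Finite S] (hS : IsPGroup p S)
    (hclass : (Group.nilpotencyClass (S ⧸ oliverSubgroup p S) : ℝ) ≤
      Real.logb 2 ((p : ℝ) - 2) + 1) :
    thompsonSubgroup p S ≤ oliverSubgroup p S := by
  have : Fact p.Prime := ⟨hp⟩
  have hp3 : 3 ≤ p := by
    have := hp.two_le
    obtain ⟨m, rfl⟩ := hodd
    omega
  have hX := centralizer_oliverSubgroup_le hodd hS
  have hCn : (Subgroup.centralizer (oliverSubgroup p S : Set S)).Normal :=
    Subgroup.normal_centralizer
  have hV := isMulCommutative_omegaOne_centralizer (p := p) hX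
  refine sSup_le fun A hA => ?_
  exact hA.1.le_of_iterCommutator_ne_bot hp hp3 hodd hS (omegaOne_le p _)
    (fun x hx => pow_eq_one_of_mem_omegaOne hx)
    (fun z hz hz1 => iterCommutator_comap_zpowers_ne_bot hz hz1) hclass
    (hA.2 _ (isElementaryAbelian_inf_sup_omegaOne hX hA.1))
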